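/- A minimal Cantor system $(X,T)$ is a nonempty compact Hausdorff space $X$ with a countable basis of clopen sets and no isolated points, together with a homeomorphism $T:X\to X$ all of whose orbits are dense. A complex number $\lambda$ is a continuous eigenvalue of $(X,T)$ if there is a continuous $f:X\to\mathbb C$, $f\neq 0$, with $f\circ T=\lambda f$. For $t\in\mathbb R$ let $|||t|||$ denote the distance from $t$ to the nearest integer. An ordered Bratteli diagram $B=(V,E,\preceq)$ consists of finite vertex sets $V_0=\{v_0\},V_1,V_2,\dots$, finite edge sets $E_1,E_2,\dots$, source and range maps $\mathsf s:E_n\to V_{n-1}$ and $\mathsf r:E_n\to V_n$, both surjective for every $n\ge 1$, and a partial order $\preceq$ on the edges, two edges being comparable if and only if they have the same range. Let $M_n$ be the $V_{n-1}\times V_n$ matrix whose entry $(u,v)$ is the number of edges of $E_n$ from $u$ to $v$, and let $h_n$ be the row vectors with $h_1=M_1$ and $h_{n}=h_{n-1}M_{n}$ for $n\ge2$. Let $X_B$ be the space of infinite paths $(x_1,x_2,\dots)$, $x_n\in E_n$, $\mathsf r(x_n)=\mathsf s(x_{n+1})$, with the topology generated by the cylinder sets. The diagram is properly ordered if there is exactly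 one path $x_{\max}$ consisting of maximal edges and exactly one path $x_{\min}$ consisting of minimal edges. The Vershik map $V_B:X_B\to X_B$ then sends $x_{\max}$ to $x_{\min}$, and sends $x\ne x_{\max}$ to $(y_1,\dots,y_{n-1},y_n,x_{n+1},x_{n+2},\dots)$, where $n$ is the least index for which $x_n$ is not maximal, $y_n$ is the successor of $x_n$, and $(y_1,\dots,y_{n-1})$ is the path of minimal edges from $v_0$ to $\mathsf s(y_n)$. The diagram $B$ is proper if it is properly ordered and (H1) all entries of $h_1$ are equal to $1$; (H2) for every $n\ge 2$ all entries of $M_n$ are positive; (H3) for every $n\ge 2$ all maximal edges of $E_n$ have the same source. For $n\geq 1$ and $x\in X_B$ the suffix vector $s_n(x)\in\mathbb N^{V_n}$ is given by $s_n(x,u)=\#\{e\in E_{n+1}: x_{n+1}\prec e,\ \mathsf s(e)=u\}$, and for $u\in V_n$, $v\in V_{n+1}$, $S_n(u,v)$ is the set of all $s_n(x)$ with $x\in X_B$ passing through $u$ and $v$. Write $\langle\cdot,\cdot\rangle$ for the Euclidean inner product. **Theorem.** Let $(X,T)$ be a minimal Cantor system given by a proper Bratteli–Vershik representation $B$, i.e.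 $B$ is proper and $(X,T)$ is topologically conjugate to $(X_B,V_B)$; identify $X$ with $X_B$ by means of a conjugacy. Let $\alpha\in\mathbb R$. The following conditions are equivalent. 1. $\lambda=\exp(2i\pi\alpha)$ is a continuous eigenvalue of $(X,T)$. 2. $\displaystyle\sum_{n\ge1}\max_{x\in X}|||\langle s_n(x),\alpha h_n\rangle|||<+\infty$. 3. $\displaystyle\sum_{n\ge1}\max_{s\in S_n(u_n,u_{n+1})}|||\langle s,\alpha h_n\rangle|||<+\infty$ for every sequence of vertices $(u_n)_{n\ge1}$ with $u_n\in V_n$. -/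

import Mathlib

universe u v w

/-! ### Dynamical systems and continuous eigenvalues -/

/-- `(X, T)` is a minimal Cantor system: `X` is a nonempty compact Hausdorff space with a countable
basis of clopen sets and without isolated points, and every orbit of the homeomorphism `T` is
dense. -/
structure IsMinimalCantorSystem {X : Type w} [TopologicalSpace X] (T : X ≃ₜ X) : Prop where
  nonempty : Nonempty X
  compact : CompactSpace X
  hausdorff : T2Space X
  clopen_basis : ∃ S : Set (Set X), S.Countable ∧ (∀ U ∈ S, IsClopen U) ∧
    TopologicalSpace.IsTopologicalBasis S
  no_isolated_points : ∀ x : X, ¬ IsOpen ({x} : Set X)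
  dense_orbits : ∀ x : X, Dense (Set.range fun k : ℤ => (T ^ k) x)

/-- `c` is a continuous eigenvalue of `(X, T)`: there is a continuous `f : X → ℂ`, not identically
zero, with `f ∘ T = c f`. -/
def IsContinuousEigenvalue {X : Type w} [TopologicalSpace X] (T : X ≃ₜ X) (c : ℂ) : Prop :=
  ∃ f : X → ℂ, Continuous f ∧ f ≠ 0 ∧ ∀ x, f (T x) = c * f x

/-- The distance from a real number to the nearest integer. -/
noncomputable def distNearestInt (t : ℝ) : ℝ := |t - round t|

/-! ### Bratteli diagrams -/

/-- A Bratteli diagram. `V n` is the (finite) set of vertices of level `n`, and `E n` is the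
(finite) set of edges joining vertices of level `n` to vertices of level `n + 1`; so `E n` is the
set usually written `E_{n+1}`. -/
structure BratteliDiagram where
  V : ℕ → Type u
  E : ℕ → Type v
  [fintypeV : ∀ n, Fintype (V n)]
  [fintypeE : ∀ n, Fintype (E n)]
  [uniqueV : Unique (V 0)]
  /-- the source of an edge -/
  src : ∀ {n}, E n → V n
  /-- the range of an edge -/
  rng : ∀ {n}, E n → V (n + 1)
  exists_src : ∀ {n} (a : V n), ∃ e : E n, src e = a
  exists_rng : ∀ {n} (b : V (n + 1)), ∃ e : E n, rng e = b

namespace BratteliDiagram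

attribute [instance] fintypeV fintypeE uniqueV

/-- The incidence matrix of the edges between levels `n` and `n + 1` (usually written `M_{n+1}`):
its `(a, b)` entry is the number of edges from `a` to `b`. -/
noncomputable def incidence (B : BratteliDiagram.{u, v}) (n : ℕ) : Matrix (B.V n) (B.V (n + 1)) ℕ :=
  Matrix.of fun a b => Nat.card {e : B.E n // B.src e = a ∧ B.rng e = b}

/-- The height row vectors: `h_0 = (1)` and `h_{n+1} = h_n M_{n+1}`, so that `h_1 = M_1` and
`h_n(a)` is the number of paths from the top vertex to `a`. -/
noncomputable def height (B : BratteliDiagram.{u, v}) : (n : ℕ) → B.V n → ℕ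
  | 0 => fun _ => 1
  | n + 1 => Matrix.vecMul (B.height n) (B.incidence n)

/-- The infinite paths starting at the top vertex. -/
def Path (B : BratteliDiagram.{u, v}) : Type v :=
  {x : (n : ℕ) → B.E n // ∀ n, B.rng (x n) = B.src (x (n + 1))}

/-- The edge of the path `x` between levels `n` and `n + 1` (usually written `x_{n+1}`). -/
def Path.edge {B : BratteliDiagram.{u, v}} (x : B.Path) (n : ℕ) : B.E n := x.1 n

/-- The vertex of level `n` through which the path `x` passes. It is the index `τ_n(x)` of the tower
of level `n` containing `x`, that tower being the set of all paths through the vertex. -/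
def Path.vertex {B : BratteliDiagram.{u, v}} (x : B.Path) (n : ℕ) : B.V n := B.src (x.edge n)

/-- The finite sets of edges are discrete. -/
instance (B : BratteliDiagram.{u, v}) (n : ℕ) : TopologicalSpace (B.E n) := ⊥

instance (B : BratteliDiagram.{u, v}) (n : ℕ) : DiscreteTopology (B.E n) := ⟨rfl⟩

/-- The topology on the path space, induced by the product of the discrete topologies; the cylinder
sets, obtained by prescribing finitely many initial edges, form a basis of it. -/
instance (B : BratteliDiagram.{u, v}) : TopologicalSpace B.Path :=
  TopologicalSpace.induced Path.edge inferInstance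

end BratteliDiagram

/-! ### Ordered Bratteli diagrams and the Vershik map -/

/-- An ordered Bratteli diagram: a partial order on edges, two edges being comparable if and only if
they have the same range. -/
structure OrderedBratteliDiagram extends BratteliDiagram.{u, v} where
  [orderE : ∀ n, PartialOrder (E n)]
  comparable_iff : ∀ {n} (e f : E n), (e ≤ f ∨ f ≤ e) ↔ rng e = rng f

namespace OrderedBratteliDiagram

attribute [instance] orderE

open BratteliDiagram

/-- All edges of `x` are (locally) maximal. -/
def IsMaxPath (B : OrderedBratteliDiagram.{u, v}) (x : B.Path) : Prop := ∀ n, IsMax (x.edge n)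

/-- All edges of `x` are (locally) minimal. -/
def IsMinPath (B : OrderedBratteliDiagram.{u, v}) (x : B.Path) : Prop := ∀ n, IsMin (x.edge n)

/-- The diagram has a unique maximal path and a unique minimal path. -/
structure IsProperlyOrdered (B : OrderedBratteliDiagram.{u, v}) : Prop where
  existsUnique_max : ∃! x : B.Path, B.IsMaxPath x
  existsUnique_min : ∃! x : B.Path, B.IsMinPath x

/-- The graph of the Vershik map: `y` is the image of `x`. Either `x` is a maximal path and `y` is a
minimal one, or, `n` being the first index at which the edge of `x` is not maximal, the edge of `y`
of index `n` is the successor of that of `x`, all the edges of `y` before it are minimal, and all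
the edges of `y` after it are those of `x`. -/
def IsVershikImage (B : OrderedBratteliDiagram.{u, v}) (x y : B.Path) : Prop :=
  (B.IsMaxPath x ∧ B.IsMinPath y) ∨
    ∃ n, (∀ i < n, IsMax (x.edge i)) ∧ ¬ IsMax (x.edge n) ∧ x.edge n ⋖ y.edge n ∧
      (∀ i < n, IsMin (y.edge i)) ∧ ∀ i, n < i → y.edge i = x.edge i

theorem rng_eq_of_le {B : OrderedBratteliDiagram.{u, v}} {n : ℕ} {e f : B.E n} (h : e ≤ f) :
    B.rng e = B.rng f := (B.comparable_iff e f).1 (Or.inl h)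

theorem exists_isMin_rng (B : OrderedBratteliDiagram.{u, v}) {n : ℕ} (b : B.V (n + 1)) :
    ∃ e : B.E n, IsMin e ∧ B.rng e = b := by
  obtain ⟨e, he⟩ := B.exists_rng b
  obtain ⟨m, hm, hmin⟩ := (Set.toFinite {f : B.E n | B.rng f = b}).exists_le_minimal (a := e) he
  refine ⟨m, fun f hf => ?_, hmin.1⟩
  exact hmin.2 ((rng_eq_of_le hf).trans hmin.1) hf

theorem isMin_unique {B : OrderedBratteliDiagram.{u, v}} {n : ℕ} {e f : B.E n} (he : IsMin e)
    (hf : IsMin f) (h : B.rng e = B.rng f) : e = f := by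
  rcases (B.comparable_iff e f).2 h with h | h
  · exact le_antisymm h (hf h)
  · exact le_antisymm (he h) h

/-- Minimal edges can be prescribed above a given tail. -/
theorem exists_min_extension (B : OrderedBratteliDiagram.{u, v}) (n : ℕ) :
    ∀ z : (i : ℕ) → B.E i, (∀ i, n ≤ i → B.rng (z i) = B.src (z (i + 1))) →
      ∃ y : B.Path, (∀ i, n ≤ i → y.edge i = z i) ∧ ∀ i < n, IsMin (y.edge i) := by
  induction n with
  | zero =>
    intro z hz
    exact ⟨⟨z, fun i => hz i (Nat.zero_le i)⟩, fun _ _ => rfl, fun i hi => absurd hi (by omega)⟩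
  | succ n ih =>
    intro z hz
    obtain ⟨e, he, hr⟩ := B.exists_isMin_rng (B.src (z (n + 1)))
    obtain ⟨y, hy, hmin⟩ := ih (Function.update z n e) (by
      intro i hi
      rcases hi.eq_or_lt with rfl | hi
      · rw [Function.update_self, Function.update_of_ne (by omega), hr]
      · rw [Function.update_of_ne (by omega), Function.update_of_ne (by omega)]
        exact hz i hi)
    refine ⟨y, fun i hi => ?_, fun i hi => ?_⟩
    · rw [hy i (by omega), Function.update_of_ne (by omega)]
    · rcases (Nat.lt_succ_iff.1 hi).eq_or_lt with rfl | hi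
      · rw [hy i le_rfl, Function.update_self]
        exact he
      · exact hmin i hi

theorem exists_isVershikImage (B : OrderedBratteliDiagram.{u, v}) (hB : B.IsProperlyOrdered)
    (x : B.Path) : ∃ y, B.IsVershikImage x y := by
  classical
  by_cases hx : B.IsMaxPath x
  · obtain ⟨y, hy, -⟩ := hB.existsUnique_min
    exact ⟨y, Or.inl ⟨hx, hy⟩⟩
  · have hex : ∃ n, ¬ IsMax (x.edge n) := not_forall.1 hx
    obtain ⟨f, hf⟩ : ∃ f, x.edge (Nat.find hex) ⋖ f := by
      obtain ⟨g, hg⟩ := not_isMax_iff.1 (Nat.find_spec hex)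
      obtain ⟨m, -, hm⟩ :=
        (Set.toFinite {f | x.edge (Nat.find hex) < f}).exists_le_minimal (a := g) hg
      exact ⟨m, hm.1, fun c hc hcm => absurd (hm.2 hc hcm.le) (not_le_of_gt hcm)⟩
    obtain ⟨y, hy, hmin⟩ := B.exists_min_extension (Nat.find hex)
      (Function.update x.1 (Nat.find hex) f) (by
        intro i hi
        rcases hi.eq_or_lt with h | hi
        · subst h
          rw [Function.update_self, Function.update_of_ne (by omega), ← rng_eq_of_le hf.le]
          exact x.2 _
        · rw [Function.update_of_ne (by omega), Function.update_of_ne (by omega)]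
          exact x.2 i)
    refine ⟨y, Or.inr ⟨Nat.find hex, fun i hi => not_not.1 (Nat.find_min hex hi),
      Nat.find_spec hex, ?_, hmin, fun i hi => ?_⟩⟩
    · rw [hy _ le_rfl, Function.update_self]
      exact hf
    · rw [hy i hi.le, Function.update_of_ne (by omega)]
      rfl

/-- The Vershik map of a properly ordered Bratteli diagram. -/
noncomputable def vershikMap (B : OrderedBratteliDiagram.{u, v}) (hB : B.IsProperlyOrdered)
    (x : B.Path) : B.Path :=
  (B.exists_isVershikImage hB x).choose

theorem vershikMap_spec (B : OrderedBratteliDiagram.{u, v}) (hB : B.IsProperlyOrdered)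
    (x : B.Path) : B.IsVershikImage x (B.vershikMap hB x) :=
  (B.exists_isVershikImage hB x).choose_spec

/-- The description of the Vershik map determines it. -/
theorem IsVershikImage.unique {B : OrderedBratteliDiagram.{u, v}} (hB : B.IsProperlyOrdered)
    {x y z : B.Path} (hy : B.IsVershikImage x y) (hz : B.IsVershikImage x z) : y = z := by
  rcases hy with ⟨hx, hy⟩ | ⟨n, h1, h2, h3, h4, h5⟩ <;>
    rcases hz with ⟨hx', hz⟩ | ⟨m, k1, k2, k3, k4, k5⟩
  · exact hB.existsUnique_min.unique hy hz
  · exact absurd (hx m) k2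
  · exact absurd (hx' n) h2
  · obtain rfl : n = m := by
      rcases lt_trichotomy n m with h | h | h
      · exact absurd (k1 n h) h2
      · exact h
      · exact absurd (h1 m h) k2
    have hge : ∀ i, n ≤ i → y.edge i = z.edge i := by
      intro i hi
      rcases hi.eq_or_lt with rfl | hi
      · have hr : B.rng (y.edge n) = B.rng (z.edge n) :=
          (rng_eq_of_le h3.le).symm.trans (rng_eq_of_le k3.le)
        rcases (B.comparable_iff _ _).2 hr with h | h
        · exact h.eq_or_lt.resolve_right (k3.2 h3.1)
        · exact (h.eq_or_lt.resolve_right (h3.2 k3.1)).symm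
      · rw [h5 i hi, k5 i hi]
    have hall : ∀ j, ∀ i, n ≤ i + j → y.edge i = z.edge i := by
      intro j
      induction j with
      | zero => exact hge
      | succ j ih =>
        intro i hi
        by_cases hn : n ≤ i
        · exact hge i hn
        · refine isMin_unique (h4 i (by omega)) (k4 i (by omega)) ?_
          have e1 : B.rng (y.edge i) = B.src (y.edge (i + 1)) := y.2 i
          have e2 : B.rng (z.edge i) = B.src (z.edge (i + 1)) := z.2 i
          rw [e1, e2, ih (i + 1) (by omega)]
    exact Subtype.ext (funext fun i => hall n i (by omega))

/-- A proper diagram: properly ordered, with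
(H1) all entries of `h_1` equal to `1`;
(H2) all incidence matrices below the first level strictly positive;
(H3) at each level below the first, all maximal edges start at the same vertex. -/
structure IsProper (B : OrderedBratteliDiagram.{u, v}) : Prop where
  properlyOrdered : B.IsProperlyOrdered
  height_one : ∀ a : B.V 1, B.height 1 a = 1
  incidence_pos : ∀ n, 1 ≤ n → ∀ a b, 0 < B.incidence n a b
  max_src : ∀ n, 1 ≤ n → ∃ a : B.V n, ∀ e : B.E n, IsMax e → B.src e = a

/-- The suffix vector `s_n(x)`, indexed by the vertices of level `n`: its coordinate at `a` is the
number of edges from `a` which are strictly larger than the edge of `x` from level `n` to level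
`n + 1`. -/
noncomputable def suffixVector (B : OrderedBratteliDiagram.{u, v}) (n : ℕ) (x : B.Path) :
    B.V n → ℕ :=
  fun a => Nat.card {e : B.E n // x.edge n < e ∧ B.src e = a}

/-- The set `S_n(a, b)` of the suffix vectors `s_n(x)` of the paths `x` passing through the vertex
`a` of level `n` and the vertex `b` of level `n + 1`. -/
def suffixSet (B : OrderedBratteliDiagram.{u, v}) (n : ℕ) (a : B.V n) (b : B.V (n + 1)) :
    Set (B.V n → ℕ) :=
  {s | ∃ x : B.Path, x.vertex n = a ∧ x.vertex (n + 1) = b ∧ B.suffixVector n x = s}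

/-- The real number `⟨s, α h_n⟩`. -/
noncomputable def pairing (B : OrderedBratteliDiagram.{u, v}) (α : ℝ) (n : ℕ) (s : B.V n → ℕ) : ℝ :=
  ∑ a : B.V n, (s a : ℝ) * (α * (B.height n a : ℝ))

/-- `φ` is a topological conjugacy from `(X, T)` to the Bratteli–Vershik system of `B`. -/
def IsConjugacy {X : Type w} [TopologicalSpace X] (T : X ≃ₜ X) (B : OrderedBratteliDiagram.{u, v})
    (hB : B.IsProperlyOrdered) (φ : X ≃ₜ B.Path) : Prop :=
  ∀ x, φ (T x) = B.vershikMap hB (φ x)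

end OrderedBratteliDiagram

/-! The sum of `⟨s_k(x), h_k⟩` over `k < n` is the exit time of `x`: the number of Vershik steps
after which its first `n` edges are all maximal. This links the suffix vectors to eigenfunctions.

From 1 to 2: after its exit time a point is uniformly close to the maximal path, so continuity of
the eigenfunction makes `α` times the sum over any far window of levels nearly an integer, uniformly
in `x` (`exists_distNearestInt_exitTime_le`). The signed offsets from the nearest integers then have
small window sums, with no wrap-around modulo 1. Maximal edges have offset zero, and (H2), (H3)
allow a path to deviate from maximal edges in any chosen set of blocks of three levels. Hence all
subsums are bounded, and the offsets converge absolutely (`IsProper.summable_abs_edge`).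

From 2 to 1: the offsets form a uniformly convergent series of continuous functions; its exponential
is an eigenfunction, since one step lowers the exit time by one and leaves the tail unchanged.

Between 2 and 3: a single vertex sequence catches near-maximizers at every other level, so two
sequences suffice. -/

section NearestInt

/-! ### Distance to the nearest integer and signed offsets -/

theorem distNearestInt_nonneg (t : ℝ) : 0 ≤ distNearestInt t := abs_nonneg _

theorem distNearestInt_le_half (t : ℝ) : distNearestInt t ≤ 1 / 2 := abs_sub_round t

theorem distNearestInt_sub_intCast (t : ℝ) (k : ℤ) :
    distNearestInt (t - k) = distNearestInt t := by
  unfold distNearestInt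
  rw [round_sub_intCast]
  push_cast
  congr 1
  ring

theorem distNearestInt_eq_abs {t : ℝ} (ht : |t| < 1 / 2) : distNearestInt t = |t| := by
  have : round t = 0 := by
    rw [round_eq_zero_iff]
    obtain ⟨h1, h2⟩ := abs_lt.1 ht
    constructor <;> linarith
  simp [distNearestInt, this]

/-- The signed distance to the nearest integer. -/
noncomputable def nearestIntOffset (t : ℝ) : ℝ := t - round t

theorem abs_nearestIntOffset (t : ℝ) : |nearestIntOffset t| = distNearestInt t := rfl

theorem nearestIntOffset_zero : nearestIntOffset 0 = 0 := by simp [nearestIntOffset]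

/-- If all partial sums of a sequence are close to integers, so that they are determined modulo `1`
by the signed distances, then the partial sums of the signed distances are small. -/
theorem abs_sum_nearestIntOffset_le {t : ℕ → ℝ} {N : ℕ}
    (h : ∀ m n, N ≤ m → m ≤ n → distNearestInt (∑ k ∈ Finset.Ico m n, t k) ≤ 1 / 8) {m n : ℕ}
    (hm : N ≤ m) (hmn : m ≤ n) : |∑ k ∈ Finset.Ico m n, nearestIntOffset (t k)| ≤ 1 / 8 := by
  induction n, hmn using Nat.le_induction with
  | base => simp
  | succ n hmn ih =>
    have h1 : |nearestIntOffset (t n)| ≤ 1 / 8 := by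
      have := h n (n + 1) (hm.trans hmn) (Nat.le_succ n)
      rwa [Nat.Ico_succ_singleton, Finset.sum_singleton] at this
    -- Since `1/8 + 1/8 < 1/2`, the enlarged sum cannot jump to another integer: its absolute value
    -- is its distance to the nearest integer, which the hypothesis bounds by `1/8` again.
    have h2 : |∑ k ∈ Finset.Ico m (n + 1), nearestIntOffset (t k)| < 1 / 2 := by
      rw [Finset.sum_Ico_succ_top hmn]
      refine (abs_add_le _ _).trans_lt ?_
      linarith
    have h3 : ∑ k ∈ Finset.Ico m (n + 1), nearestIntOffset (t k) =
        ∑ k ∈ Finset.Ico m (n + 1), t k - ((∑ k ∈ Finset.Ico m (n + 1), round (t k) : ℤ) : ℝ) := by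
      push_cast
      rw [← Finset.sum_sub_distrib]
      rfl
    rw [← distNearestInt_eq_abs h2, h3, distNearestInt_sub_intCast]
    exact h m (n + 1) hm (by omega)

/-- With `δ` the signed offset, the chord length is `2 |sin (π δ)|`, and Jordan's inequality `|sin
y| ≥ (2/π) |y|` applies because `|π δ| ≤ π/2`. -/
theorem distNearestInt_le_norm_exp_sub_one (t : ℝ) :
    4 * distNearestInt t ≤ ‖Complex.exp (2 * Complex.I * Real.pi * t) - 1‖ := by
  have h1 : Complex.exp (2 * Complex.I * Real.pi * t) =
      Complex.exp (Complex.I * ((2 * Real.pi * nearestIntOffset t : ℝ) : ℂ)) := by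
    rw [Complex.exp_eq_exp_iff_exists_int]
    refine ⟨round t, ?_⟩
    simp only [nearestIntOffset]
    push_cast
    ring
  rw [h1, Complex.norm_exp_I_mul_ofReal_sub_one, ← abs_nearestIntOffset, norm_mul, Real.norm_eq_abs,
    Real.norm_eq_abs, abs_two]
  have h2 : |2 * Real.pi * nearestIntOffset t / 2| ≤ Real.pi / 2 := by
    rw [show 2 * Real.pi * nearestIntOffset t / 2 = Real.pi * nearestIntOffset t by ring, abs_mul,
      abs_of_pos Real.pi_pos, abs_nearestIntOffset]
    have := distNearestInt_le_half t
    nlinarith [Real.pi_pos]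
  have h3 := Real.mul_abs_le_abs_sin h2
  rw [show 2 * Real.pi * nearestIntOffset t / 2 = Real.pi * nearestIntOffset t by ring] at h3 ⊢
  rw [abs_mul, abs_of_pos Real.pi_pos, ← mul_assoc, div_mul_cancel₀ _ Real.pi_pos.ne'] at h3
  linarith

end NearestInt

/-! ### Real series: residues modulo three and subsums -/

section Sums

theorem sum_range_three_mul (g : ℕ → ℝ) (J : ℕ) : ∑ k ∈ Finset.range (3 * J), g k =
    ∑ j ∈ Finset.range J, (g (3 * j) + g (3 * j + 1) + g (3 * j + 2)) := by
  induction J with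
  | zero => simp
  | succ J ih =>
    rw [Finset.sum_range_succ, ← ih, show 3 * (J + 1) = 3 * J + 1 + 1 + 1 by ring]
    simp only [Finset.sum_range_succ]
    ring

/-- The starting points `N`, `N + 1`, `N + 2` cover the three residue classes, so the partial sums
beyond `N` are at most `3 c`. -/
theorem summable_of_sum_range_three_mul_le {g : ℕ → ℝ} (hg : ∀ n, 0 ≤ g n) (N : ℕ) (c : ℝ)
    (h : ∀ m, N ≤ m → ∀ J, ∑ j ∈ Finset.range J, g (m + 3 * j) ≤ c) : Summable g := by
  rw [← summable_nat_add_iff N]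
  refine summable_of_sum_range_le (c := c + c + c) (fun n => hg _) fun n => ?_
  calc ∑ k ∈ Finset.range n, g (k + N)
      ≤ ∑ k ∈ Finset.range (3 * n), g (k + N) :=
        Finset.sum_le_sum_of_subset_of_nonneg (Finset.range_mono (by omega)) fun i _ _ => hg _
    _ = ∑ j ∈ Finset.range n, g (N + 3 * j) + ∑ j ∈ Finset.range n, g (N + 1 + 3 * j) +
          ∑ j ∈ Finset.range n, g (N + 2 + 3 * j) := by
        rw [sum_range_three_mul, ← Finset.sum_add_distrib, ← Finset.sum_add_distrib]
        refine Finset.sum_congr rfl fun j _ => ?_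
        congr 1
        · congr 1
          · congr 1; ring
          · congr 1; ring
        · congr 1; ring
    _ ≤ c + c + c := by
        gcongr
        exacts [h _ le_rfl n, h _ (by omega) n, h _ (by omega) n]

/-- If all subsums of a finite sum are bounded by `c`, the sum of absolute values is at most
`2 c`. -/
theorem sum_abs_le_of_subsums {p : ℕ → ℝ} {J : ℕ} {c : ℝ}
    (h : ∀ A : Set ℕ, |∑ j ∈ Finset.range J, A.indicator p j| ≤ c) :
    ∑ j ∈ Finset.range J, |p j| ≤ 2 * c := by
  have h1 := (abs_le.1 (h {j | 0 ≤ p j})).2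
  have h2 := (abs_le.1 (h {j | ¬ 0 ≤ p j})).1
  have h3 : ∀ j, |p j| = {j | 0 ≤ p j}.indicator p j - {j | ¬ 0 ≤ p j}.indicator p j := by
    intro j
    by_cases hj : 0 ≤ p j
    · simp [hj, abs_of_nonneg hj]
    · simp [hj, not_le.1 hj, abs_of_neg (not_le.1 hj)]
  rw [Finset.sum_congr rfl fun j _ => h3 j, Finset.sum_sub_distrib]
  linarith

end Sums

/-! ### Heights and exit times -/

namespace OrderedBratteliDiagram

open BratteliDiagram

/-- The number `⟨s_n(x), h_n⟩` as a function of the edge of `x` below level `n`. -/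
noncomputable def upperHeight (B : OrderedBratteliDiagram.{u, v}) (n : ℕ) (e : B.E n) : ℕ :=
  ∑ a : B.V n, Nat.card {e' : B.E n // e < e' ∧ B.src e' = a} * B.height n a

variable {B : OrderedBratteliDiagram.{u, v}}

theorem pairing_suffixVector (α : ℝ) (n : ℕ) (x : B.Path) :
    B.pairing α n (B.suffixVector n x) = α * B.upperHeight n (x.edge n) := by
  unfold pairing suffixVector upperHeight
  push_cast
  rw [Finset.mul_sum]
  exact Finset.sum_congr rfl fun a _ => by ring

open Classical in
theorem sum_card_mul_height (n : ℕ) (p : B.E n → Prop) :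
    ∑ a : B.V n, Nat.card {e : B.E n // p e ∧ B.src e = a} * B.height n a =
      ∑ e with p e, B.height n (B.src e) := by
  rw [← Finset.sum_fiberwise (Finset.univ.filter p) (fun e => B.src e)]
  refine Finset.sum_congr rfl fun a _ => ?_
  rw [Finset.filter_filter, Finset.sum_congr rfl
    (g := fun _ => B.height n a) (by intro e he; rw [(Finset.mem_filter.1 he).2.2]),
    Finset.sum_const, smul_eq_mul, Nat.card_eq_fintype_card, Fintype.card_subtype]

open Classical in
theorem upperHeight_eq_sum (n : ℕ) (e : B.E n) :
    B.upperHeight n e = ∑ e' with e < e', B.height n (B.src e') :=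
  sum_card_mul_height n _

open Classical in
theorem height_succ (n : ℕ) (b : B.V (n + 1)) :
    B.height (n + 1) b = ∑ e with B.rng e = b, B.height n (B.src e) := by
  rw [← sum_card_mul_height]
  change Matrix.vecMul (B.height n) (B.incidence n) b = _
  rw [Matrix.vecMul, dotProduct]
  refine Finset.sum_congr rfl fun a _ => ?_
  rw [mul_comm]
  simp only [incidence, Matrix.of_apply, and_comm]

theorem height_pos (n : ℕ) (a : B.V n) : 0 < B.height n a := by
  classical
  induction n with
  | zero => exact one_pos
  | succ n ih =>
    rw [height_succ]
    obtain ⟨e, he⟩ := B.exists_rng a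
    exact Finset.sum_pos (fun e _ => ih _) ⟨e, by simp [he]⟩

theorem upperHeight_eq_zero {n : ℕ} {e : B.E n} : B.upperHeight n e = 0 ↔ IsMax e := by
  classical
  rw [upperHeight_eq_sum, isMax_iff_forall_not_lt, Finset.sum_eq_zero_iff]
  simp only [Finset.mem_filter, Finset.mem_univ, true_and, (height_pos _ _).ne', imp_false]

theorem lt_iff_of_covBy {n : ℕ} {e f g : B.E n} (h : e ⋖ f) : e < g ↔ g = f ∨ f < g := by
  constructor
  · intro hg
    have hr : B.rng f = B.rng g := (rng_eq_of_le h.le).symm.trans (rng_eq_of_le hg.le)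
    rcases (B.comparable_iff _ _).2 hr with h' | h'
    · exact h'.eq_or_lt.imp Eq.symm id
    · exact Or.inl (h'.eq_or_lt.resolve_right (h.2 hg))
  · rintro (rfl | hg)
    · exact h.1
    · exact h.1.trans hg

theorem upperHeight_covBy {n : ℕ} {e f : B.E n} (h : e ⋖ f) :
    B.upperHeight n e = B.upperHeight n f + B.height n (B.src f) := by
  classical
  simp only [upperHeight_eq_sum, lt_iff_of_covBy h]
  rw [Finset.filter_or, Finset.sum_union, add_comm]
  · rw [Finset.sum_eq_single_of_mem (s := Finset.univ.filter (· = f)) f (by simp)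
      (by simp +contextual)]
  · rw [Finset.disjoint_filter]
    rintro x - rfl
    exact lt_irrefl _

theorem upperHeight_isMin {n : ℕ} {e : B.E n} (h : IsMin e) :
    B.upperHeight n e + B.height n (B.src e) = B.height (n + 1) (B.rng e) := by
  classical
  have key : ∀ g : B.E n, B.rng g = B.rng e ↔ g = e ∨ e < g := by
    intro g
    constructor
    · intro hg
      rcases (B.comparable_iff _ _).2 hg with h' | h'
      · exact Or.inl (le_antisymm h' (h h'))
      · exact h'.eq_or_lt.imp Eq.symm id
    · rintro (rfl | hg)
      · rfl
      · exact (rng_eq_of_le hg.le).symm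
  simp only [upperHeight_eq_sum, height_succ, key]
  rw [Finset.filter_or, Finset.sum_union, add_comm]
  · rw [Finset.sum_eq_single_of_mem (s := Finset.univ.filter (· = e)) e (by simp)
      (by simp +contextual)]
  · rw [Finset.disjoint_filter]
    rintro x - rfl
    exact lt_irrefl _

/-- The number of iterations of the Vershik map which make the first `n` edges of `x` maximal. -/
noncomputable def exitTime (B : OrderedBratteliDiagram.{u, v}) (n : ℕ) (x : B.Path) : ℕ :=
  ∑ k ∈ Finset.range n, B.upperHeight k (x.edge k)

theorem exitTime_eq_zero {n : ℕ} {x : B.Path} :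
    B.exitTime n x = 0 ↔ ∀ i < n, IsMax (x.edge i) := by
  simp [exitTime, Finset.sum_eq_zero_iff, upperHeight_eq_zero]

/-- Along minimal edges `upperHeight` is the increment of the height between consecutive levels, so
the sum telescopes down to `h_0 = 1`. -/
theorem exitTime_add_one_of_isMin {n : ℕ} {x : B.Path} (h : ∀ i < n, IsMin (x.edge i)) :
    B.exitTime n x + 1 = B.height n (x.vertex n) := by
  induction n with
  | zero => simp [exitTime, height]
  | succ n ih =>
    have h1 := upperHeight_isMin (h n n.lt_succ_self)
    have h2 : B.rng (x.edge n) = x.vertex (n + 1) := x.2 n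
    have h3 := ih fun i hi => h i (hi.trans n.lt_succ_self)
    rw [h2] at h1
    rw [exitTime, Finset.sum_range_succ, ← exitTime]
    change B.upperHeight n (x.edge n) + B.height n (x.vertex n) = _ at h1
    omega

/-- One step of the Vershik map decreases the exit time by one, as long as it is positive. -/
theorem exitTime_vershikImage {x y : B.Path} {n : ℕ} (h : B.IsVershikImage x y)
    (hn : B.exitTime n x ≠ 0) : B.exitTime n x = B.exitTime n y + 1 := by
  rcases h with ⟨hx, -⟩ | ⟨m, h1, h2, h3, h4, h5⟩
  · exact absurd (exitTime_eq_zero.2 fun i _ => hx i) hn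
  · have hmn : m < n := by
      by_contra hmn
      exact hn (exitTime_eq_zero.2 fun i hi => h1 i (by omega))
    -- Below level `m` the sum rises from `0` to `h_m - 1`, `h_m` being taken at the source of the
    -- new edge; at level `m` it drops by exactly `h_m`; above, nothing changes. The net change is
    -- `-1`.
    have hx : B.exitTime m x = 0 := exitTime_eq_zero.2 h1
    have hy := exitTime_add_one_of_isMin h4
    have hc := upperHeight_covBy h3
    have hs : ∀ z : B.Path, B.exitTime n z = B.exitTime m z + B.upperHeight m (z.edge m) +
        ∑ k ∈ Finset.Ico (m + 1) n, B.upperHeight k (z.edge k) := by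
      intro z
      rw [exitTime, exitTime, ← Finset.sum_range_succ, Finset.sum_range_add_sum_Ico _ hmn]
    have ht : ∑ k ∈ Finset.Ico (m + 1) n, B.upperHeight k (x.edge k) =
        ∑ k ∈ Finset.Ico (m + 1) n, B.upperHeight k (y.edge k) :=
      Finset.sum_congr rfl fun k hk => by rw [h5 k (Finset.mem_Ico.1 hk).1]
    rw [hs x, hs y, ht, hx, hc]
    change B.exitTime m y + 1 = B.height m (B.src (y.edge m)) at hy
    omega

theorem exists_isMax_rng {n : ℕ} (b : B.V (n + 1)) : ∃ e : B.E n, IsMax e ∧ B.rng e = b := by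
  obtain ⟨e, he⟩ := B.exists_rng b
  obtain ⟨m, hm, hmax⟩ := (Set.toFinite {f : B.E n | B.rng f = b}).exists_le_maximal (a := e) he
  refine ⟨m, fun f hf => ?_, hmax.1⟩
  exact hmax.2 ((rng_eq_of_le hf).symm.trans hmax.1) hf

theorem continuous_edge (n : ℕ) : Continuous fun x : B.Path => x.edge n :=
  (continuous_apply n).comp continuous_induced_dom

end OrderedBratteliDiagram

/-! ### Eigenfunctions near the maximal path -/

namespace OrderedBratteliDiagram

open BratteliDiagram

variable {B : OrderedBratteliDiagram.{u, v}}

/-- The point `z` is the iterate of `x` under `T` at its exit time, each step contributing one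
factor `c`. -/
theorem exists_isMax_eigenfunction {X : Type w} [TopologicalSpace X] {T : X ≃ₜ X}
    {hB : B.IsProperlyOrdered} {φ : X ≃ₜ B.Path} (hφ : IsConjugacy T B hB φ) {f : X → ℂ} {c : ℂ}
    (hf : ∀ x, f (T x) = c * f x) (n : ℕ) (x : X) :
    ∃ z, (∀ i < n, IsMax ((φ z).edge i)) ∧ f z = c ^ B.exitTime n (φ x) * f x := by
  induction hk : B.exitTime n (φ x) generalizing x with
  | zero => exact ⟨x, exitTime_eq_zero.1 hk, by simp⟩
  | succ k ih =>
    have h1 := exitTime_vershikImage (n := n) (B.vershikMap_spec hB (φ x)) (by omega)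
    rw [← hφ] at h1
    obtain ⟨z, hz, hfz⟩ := ih (T x) (by omega)
    exact ⟨z, hz, by rw [hfz, hf, pow_succ, mul_assoc]⟩

/-- The paths with many maximal edges are close to the maximal path. -/
theorem exists_forall_isMax_mem [CompactSpace B.Path] {m : B.Path}
    (hm : ∀ x, B.IsMaxPath x → x = m) {U : Set B.Path} (hU : IsOpen U) (hmU : m ∈ U) :
    ∃ N, ∀ z : B.Path, (∀ i < N, IsMax (z.edge i)) → z ∈ U := by
  let K : ℕ → Set B.Path := fun n => {z | ∀ i < n, IsMax (z.edge i)}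
  have hK : ∀ n, IsClosed (K n) := by
    intro n
    have : K n = ⋂ i, ⋂ _ : i < n, (fun z : B.Path => z.edge i) ⁻¹' {e | IsMax e} := by
      ext z; simp [K]
    rw [this]
    exact isClosed_iInter fun i => isClosed_iInter fun _ =>
      (isClosed_discrete _).preimage (continuous_edge i)
  have hdir : Directed (fun s t => t ⊆ s) K := by
    intro i j
    exact ⟨max i j, fun z hz k hk => hz k (hk.trans_le (le_max_left _ _)),
      fun z hz k hk => hz k (hk.trans_le (le_max_right _ _))⟩
  -- The closed sets `K n` decrease to the set of maximal paths, which avoids the compact complement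
  -- of `U`; so some `K N` already avoids it.
  obtain ⟨N, hN⟩ := hU.isClosed_compl.isCompact.elim_directed_family_closed K hK
    (by
      rw [Set.eq_empty_iff_forall_notMem]
      rintro z ⟨hzU, hz⟩
      have : B.IsMaxPath z := fun n => Set.mem_iInter.1 hz (n + 1) n n.lt_succ_self
      exact hzU (hm z this ▸ hmU)) hdir
  refine ⟨N, fun z hz => ?_⟩
  by_contra hzU
  exact Set.eq_empty_iff_forall_notMem.1 hN z ⟨hzU, hz⟩

end OrderedBratteliDiagram

/-- The zero set is closed and invariant under `T` and its inverse, so a single zero brings in a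
dense orbit and forces `f = 0`. -/
theorem eigenfunction_ne_zero {X : Type w} [TopologicalSpace X] {T : X ≃ₜ X}
    (hT : IsMinimalCantorSystem T) {f : X → ℂ} (hf : Continuous f) (hf0 : f ≠ 0) {c : ℂ}
    (hc : c ≠ 0) (h : ∀ x, f (T x) = c * f x) (x : X) : f x ≠ 0 := by
  intro hx
  apply hf0
  have hpow : ∀ (k : ℕ) (y : X), f y = 0 → f ((T ^ k) y) = 0 := by
    intro k
    induction k with
    | zero => exact fun y hy => hy
    | succ k ih =>
      intro y hy
      rw [pow_succ]
      exact ih (T y) (by rw [h, hy, mul_zero])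
  have hinv : ∀ (k : ℕ) (y : X), f y = 0 → f ((T⁻¹ ^ k) y) = 0 := by
    intro k
    induction k with
    | zero => exact fun y hy => hy
    | succ k ih =>
      intro y hy
      rw [pow_succ]
      refine ih (T⁻¹ y) ?_
      have := h (T⁻¹ y)
      rw [show T (T⁻¹ y) = y from T.apply_symm_apply y, hy] at this
      exact (mul_eq_zero.1 this.symm).resolve_left hc
  have hS : IsClosed {y | f y = 0} := isClosed_eq hf continuous_const
  have hr : (Set.range fun k : ℤ => (T ^ k) x) ⊆ {y | f y = 0} := by
    rintro _ ⟨k, rfl⟩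
    obtain ⟨k, rfl | rfl⟩ := k.eq_nat_or_neg
    · simpa using hpow k x hx
    · simpa using hinv k x hx
  funext y
  exact hS.closure_subset_iff.2 hr (hT.dense_orbits x y)

namespace OrderedBratteliDiagram

variable {B : OrderedBratteliDiagram.{u, v}}

theorem exists_distNearestInt_exitTime_le {X : Type w} [TopologicalSpace X] {T : X ≃ₜ X}
    (hT : IsMinimalCantorSystem T) {hB : B.IsProperlyOrdered} {φ : X ≃ₜ B.Path}
    (hφ : IsConjugacy T B hB φ) {α : ℝ}
    (h : IsContinuousEigenvalue T (Complex.exp (2 * Complex.I * (Real.pi : ℂ) * (α : ℂ)))) :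
    ∃ N, ∀ m n, N ≤ m → m ≤ n → ∀ x : B.Path,
      distNearestInt (∑ k ∈ Finset.Ico m n, α * B.upperHeight k (x.edge k)) ≤ 1 / 8 := by
  obtain ⟨f, hf, hf0, hfT⟩ := h
  have := hT.compact
  have : CompactSpace B.Path := φ.compactSpace
  obtain ⟨p, -, hp⟩ := hB.existsUnique_max
  have hfp := eigenfunction_ne_zero hT hf hf0 (Complex.exp_ne_zero _) hfT (φ.symm p)
  set r := ‖f (φ.symm p)‖ with hr
  have hr0 : 0 < r := norm_pos_iff.2 hfp
  have hfc : Continuous fun z : B.Path => ‖f (φ.symm z) - f (φ.symm p)‖ :=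
    ((hf.comp φ.symm.continuous).sub continuous_const).norm
  -- The radius `r/10` gives `‖c ^ s - 1‖ ‖w‖ ≤ r/5` with `‖w‖ ≥ 9r/10`, hence `‖c ^ s - 1‖ ≤ 2/9`,
  -- below the value `1/2 = 4 · 1/8` needed at the end.
  obtain ⟨N, hN⟩ := exists_forall_isMax_mem hp
    (U := {z | ‖f (φ.symm z) - f (φ.symm p)‖ < r / 10})
    (isOpen_lt hfc continuous_const) (by simpa using by linarith)
  refine ⟨N, fun m n hm hmn x => ?_⟩
  set c := Complex.exp (2 * Complex.I * (Real.pi : ℂ) * (α : ℂ)) with hc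
  have hc1 : ‖c‖ = 1 := by
    rw [hc, show 2 * Complex.I * (Real.pi : ℂ) * (α : ℂ) = ((2 * Real.pi * α : ℝ) : ℂ) * Complex.I
      by push_cast; ring]
    exact Complex.norm_exp_ofReal_mul_I _
  have key : ∀ k, N ≤ k →
      ‖c ^ B.exitTime k x * f (φ.symm x) - f (φ.symm p)‖ < r / 10 := by
    intro k hk
    obtain ⟨z, hz, hfz⟩ := exists_isMax_eigenfunction hφ hfT k (φ.symm x)
    have := hN (φ z) fun i hi => hz i (hi.trans_le hk)
    simpa [hfz] using this
  have hsplit : B.exitTime n x =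
      B.exitTime m x + ∑ k ∈ Finset.Ico m n, B.upperHeight k (x.edge k) :=
    (Finset.sum_range_add_sum_Ico _ hmn).symm
  set s := ∑ k ∈ Finset.Ico m n, B.upperHeight k (x.edge k) with hs
  have h1 := key m hm
  have h2 := key n (hm.trans hmn)
  set w := c ^ B.exitTime m x * f (φ.symm x) with hw
  have h3 : c ^ B.exitTime n x * f (φ.symm x) = c ^ s * w := by
    rw [hsplit, pow_add, hw]; ring
  rw [h3] at h2
  have h4 : ‖c ^ s - 1‖ * ‖w‖ ≤ r / 10 + r / 10 := by
    rw [← norm_mul, show (c ^ s - 1) * w = (c ^ s * w - f (φ.symm p)) - (w - f (φ.symm p)) by ring]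
    exact (norm_sub_le _ _).trans (add_le_add h2.le h1.le)
  have h5 : 9 / 10 * r ≤ ‖w‖ := by
    have := norm_sub_norm_le (f (φ.symm p)) w
    rw [norm_sub_rev] at this
    linarith
  have h6 : c ^ s = Complex.exp (2 * Complex.I * (Real.pi : ℂ) * ((α * s : ℝ) : ℂ)) := by
    rw [hc, ← Complex.exp_nat_mul]
    congr 1
    push_cast
    ring
  have h7 := distNearestInt_le_norm_exp_sub_one (α * s)
  rw [← h6] at h7
  have h8 : ∑ k ∈ Finset.Ico m n, α * (B.upperHeight k (x.edge k) : ℝ) = α * s := by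
    rw [← Finset.mul_sum, hs]; push_cast; rfl
  rw [h8]
  by_contra hcon
  have h9 : 1 / 2 < ‖c ^ s - 1‖ := by linarith
  nlinarith

/-! ### Splicing paths and absolute summability -/

/-- The path which, in blocks of three levels starting at level `m`, follows the edges `e` and `f`
if the index of the block is in `A`, and otherwise only maximal edges; the last edge of each block
is maximal. -/
theorem exists_block_path {a : ∀ n, B.V n} (ha : ∀ n (e : B.E n), IsMax e → B.src e = a n)
    {e f : ∀ n, B.E n} (hef : ∀ n, B.src (f (n + 1)) = B.rng (e n))
    (hf : ∀ n, B.rng (f (n + 1)) = a (n + 2)) (m : ℕ) (A : Set ℕ) :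
    ∃ x : B.Path, ∀ j,
      (j ∈ A → x.edge (m + 3 * j) = e (m + 3 * j) ∧ x.edge (m + 3 * j + 1) = f (m + 3 * j + 1)) ∧
      (j ∉ A → IsMax (x.edge (m + 3 * j)) ∧ IsMax (x.edge (m + 3 * j + 1))) ∧
      IsMax (x.edge (m + 3 * j + 2)) := by
  classical
  choose mx hmx hmr using fun n => exists_isMax_rng (B := B) (n := n)
  -- The opening edge of a block is defined separately because the third edge of the preceding block
  -- must end at its source. Below `m` the truncated `i - m` gives irrelevant values, later replaced
  -- by minimal edges.
  let first : ∀ i, B.E i := fun i => if (i - m) / 3 ∈ A then e i else mx i (a (i + 1))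
  let z : ∀ i, B.E i := fun i =>
    if (i - m) % 3 = 0 then first i
    else if (i - m) % 3 = 1 then (if (i - m) / 3 ∈ A then f i else mx i (a (i + 1)))
    else mx i (B.src (first (i + 1)))
  have z0 : ∀ j, z (m + 3 * j) = if j ∈ A then e (m + 3 * j) else mx _ (a (m + 3 * j + 1)) := by
    intro j
    have h1 : (m + 3 * j - m) % 3 = 0 := by omega
    have h2 : (m + 3 * j - m) / 3 = j := by omega
    simp only [z, first, h1, h2, if_true]
  have z1 : ∀ j, z (m + 3 * j + 1) =
      if j ∈ A then f (m + 3 * j + 1) else mx _ (a (m + 3 * j + 1 + 1)) := by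
    intro j
    have h1 : (m + 3 * j + 1 - m) % 3 = 1 := by omega
    have h2 : (m + 3 * j + 1 - m) / 3 = j := by omega
    simp only [z, h1, h2, if_true, one_ne_zero, if_false]
  have z2 : ∀ j, z (m + 3 * j + 2) = mx _ (B.src (z (m + 3 * j + 2 + 1))) := by
    intro j
    have h1 : (m + 3 * j + 2 - m) % 3 = 2 := by omega
    have h2 : (m + 3 * j + 2 + 1 - m) % 3 = 0 := by omega
    have h3 : z (m + 3 * j + 2 + 1) = first (m + 3 * j + 2 + 1) := by simp only [z, h2, if_true]
    rw [h3]
    simp [z, h1]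
  obtain ⟨x, hx, -⟩ := B.exists_min_extension m z (by
    intro i hi
    obtain ⟨j, t, ht, rfl⟩ : ∃ j t, t < 3 ∧ i = m + 3 * j + t :=
      ⟨(i - m) / 3, (i - m) % 3, Nat.mod_lt _ (by norm_num), by omega⟩
    interval_cases t
    · rw [add_zero, z0, z1]
      split_ifs
      · exact (hef _).symm
      · rw [hmr, ha _ _ (hmx _ _)]
    · have h := ha _ _ (hmx (m + 3 * j + 2) (B.src (z (m + 3 * j + 2 + 1))))
      rw [← z2] at h
      rw [h, z1]
      split_ifs
      · exact hf _
      · rw [hmr]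
    · have h := hmr (m + 3 * j + 2) (B.src (z (m + 3 * j + 2 + 1)))
      rwa [← z2] at h)
  refine ⟨x, fun j => ⟨fun hj => ⟨?_, ?_⟩, fun hj => ⟨?_, ?_⟩, ?_⟩⟩
  · rw [hx _ (by omega), z0, if_pos hj]
  · rw [hx _ (by omega), z1, if_pos hj]
  · rw [hx _ (by omega), z0, if_neg hj]; exact hmx _ _
  · rw [hx _ (by omega), z1, if_neg hj]; exact hmx _ _
  · rw [hx _ (by omega), z2]; exact hmx _ _

/-- If the sums over paths of a function of the edges, zero on maximal edges, are bounded, then its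
values on consecutive pairs of edges ending at the source of the maximal edges are absolutely
summable in steps of three levels. -/
theorem sum_abs_pair_le {a : ∀ n, B.V n} (ha : ∀ n (e : B.E n), IsMax e → B.src e = a n)
    {d : ∀ n, B.E n → ℝ} (hd : ∀ n e, IsMax e → d n e = 0) {N : ℕ} {c : ℝ}
    (hb : ∀ m n, N ≤ m → m ≤ n → ∀ x : B.Path, |∑ k ∈ Finset.Ico m n, d k (x.edge k)| ≤ c)
    {e f : ∀ n, B.E n} (hef : ∀ n, B.src (f (n + 1)) = B.rng (e n))
    (hf : ∀ n, B.rng (f (n + 1)) = a (n + 2)) {m : ℕ} (hm : N ≤ m) (J : ℕ) :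
    ∑ j ∈ Finset.range J, |d (m + 3 * j) (e (m + 3 * j)) + d (m + 3 * j + 1) (f (m + 3 * j + 1))|
      ≤ 2 * c := by
  classical
  refine sum_abs_le_of_subsums (p := fun j =>
    d (m + 3 * j) (e (m + 3 * j)) + d (m + 3 * j + 1) (f (m + 3 * j + 1))) fun A => ?_
  obtain ⟨x, hx⟩ := exists_block_path ha hef hf m A
  refine le_of_eq_of_le (congrArg _ ?_) (hb m (m + 3 * J) hm (by omega) x)
  rw [Finset.sum_Ico_eq_sum_range, Nat.add_sub_cancel_left, sum_range_three_mul]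
  refine Finset.sum_congr rfl fun j _ => ?_
  obtain ⟨h1, h2, h3⟩ := hx j
  rw [← add_assoc, ← add_assoc, hd _ _ h3]
  by_cases hj : j ∈ A
  · rw [Set.indicator_of_mem hj, (h1 hj).1, (h1 hj).2, add_zero]
  · rw [Set.indicator_of_notMem hj, hd _ _ (h2 hj).1, hd _ _ (h2 hj).2]; simp

theorem IsProper.exists_edge (hB : B.IsProper) {n : ℕ} (a : B.V n) (b : B.V (n + 1)) (hn : 1 ≤ n) :
    ∃ e : B.E n, B.src e = a ∧ B.rng e = b := by
  have h := hB.incidence_pos n hn a b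
  obtain ⟨e, he⟩ := (Nat.card_pos_iff.1 h).1
  exact ⟨e, he⟩

theorem IsProper.exists_max_src (hB : B.IsProper) (n : ℕ) :
    ∃ a : B.V n, ∀ e : B.E n, IsMax e → B.src e = a := by
  cases n with
  | zero => exact ⟨default, fun e _ => Subsingleton.elim _ _⟩
  | succ n => exact hB.max_src (n + 1) (by omega)

/-- An arbitrary edge `e n` is followed by an edge leading back to the common source `a (n + 2)` of
the maximal edges, which exists by (H2). This bounds the paired contributions; the added edge is
then removed by bounding its contribution alone. -/
theorem IsProper.summable_abs_edge (hB : B.IsProper) {d : ∀ n, B.E n → ℝ}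
    (hd : ∀ n e, IsMax e → d n e = 0) {N : ℕ} {c : ℝ}
    (hb : ∀ m n, N ≤ m → m ≤ n → ∀ x : B.Path, |∑ k ∈ Finset.Ico m n, d k (x.edge k)| ≤ c)
    (e : ∀ n, B.E n) : Summable fun n => |d n (e n)| := by
  choose a ha using hB.exists_max_src
  choose mx hmx hmr using fun n => exists_isMax_rng (B := B) (n := n)
  choose F hF1 hF2 using fun n => hB.exists_edge (B.rng (e n)) (a (n + 2)) (by omega)
  -- Only the values `f (n + 1)` matter; `e 0` merely fills level `0`.
  let f : ∀ n, B.E n := fun n => Nat.casesOn n (e 0) F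
  refine summable_of_sum_range_three_mul_le (fun n => abs_nonneg _) N (2 * c + 2 * c)
    fun m hm J => ?_
  have h1 := sum_abs_pair_le (f := f) ha hd hb hF1 hF2 hm J
  -- With a maximal edge before `f`, the first term of the pair vanishes and the bound concerns `f`
  -- alone.
  have h2 := sum_abs_pair_le (e := fun n => mx n (B.src (f (n + 1)))) (f := f) ha hd hb
    (fun n => (hmr _ _).symm) hF2 hm J
  refine le_trans ?_ (add_le_add h1 h2)
  rw [← Finset.sum_add_distrib]
  refine Finset.sum_le_sum fun j _ => ?_
  rw [hd _ _ (hmx _ _), zero_add]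
  have := abs_sub (d (m + 3 * j) (e (m + 3 * j)) + d (m + 3 * j + 1) (f (m + 3 * j + 1)))
    (d (m + 3 * j + 1) (f (m + 3 * j + 1)))
  rwa [add_sub_cancel_right] at this

/-! ### Eigenvalues and summability of suffix suprema -/

theorem bddAbove_range_distNearestInt {ι : Sort*} (g : ι → ℝ) :
    BddAbove (Set.range fun i => distNearestInt (g i)) := by
  refine ⟨1 / 2, ?_⟩
  rintro _ ⟨i, rfl⟩
  exact distNearestInt_le_half _

theorem summable_iSup_of_eigenvalue {X : Type w} [TopologicalSpace X] {T : X ≃ₜ X}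
    (hT : IsMinimalCantorSystem T) (hB : B.IsProper) {φ : X ≃ₜ B.Path}
    (hφ : IsConjugacy T B hB.properlyOrdered φ) {α : ℝ}
    (h : IsContinuousEigenvalue T (Complex.exp (2 * Complex.I * (Real.pi : ℂ) * (α : ℂ)))) :
    Summable fun n : ℕ => ⨆ x : X,
      distNearestInt (B.pairing α (n + 1) (B.suffixVector (n + 1) (φ x))) := by
  have := hT.nonempty
  obtain ⟨N, hN⟩ := exists_distNearestInt_exitTime_le hT hφ h
  have hE : ∀ n, Nonempty (B.E n) := fun n => ⟨(φ (Classical.arbitrary X)).edge n⟩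
  -- The offset depends only on one of finitely many edges, so the supremum over points is
  -- controlled by one chosen edge per level. These edges need not form a path.
  have hmax : ∀ n, ∃ e : B.E n, ∀ e', distNearestInt (α * B.upperHeight n e') ≤
      distNearestInt (α * B.upperHeight n e) := fun n => Finite.exists_max _
  choose e he using hmax
  have hs : Summable fun n => |nearestIntOffset (α * B.upperHeight n (e n))| :=
    hB.summable_abs_edge (d := fun n e => nearestIntOffset (α * B.upperHeight n e))
      (fun n e hme => by simp [upperHeight_eq_zero.2 hme, nearestIntOffset_zero])
      (fun m n hm hmn x =>
        abs_sum_nearestIntOffset_le (fun m n hm hmn => hN m n hm hmn x) hm hmn) e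
  refine Summable.of_nonneg_of_le (fun n => Real.iSup_nonneg fun x => distNearestInt_nonneg _)
    (fun n => ciSup_le fun x => ?_) ((summable_nat_add_iff 1).2 hs)
  rw [pairing_suffixVector]
  exact he _ _

theorem eigenvalue_of_summable_iSup {X : Type w} [TopologicalSpace X] {T : X ≃ₜ X}
    (hT : IsMinimalCantorSystem T) {hB : B.IsProperlyOrdered} {φ : X ≃ₜ B.Path}
    (hφ : IsConjugacy T B hB φ) {α : ℝ}
    (h : Summable fun n : ℕ => ⨆ x : X,
      distNearestInt (B.pairing α (n + 1) (B.suffixVector (n + 1) (φ x)))) :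
    IsContinuousEigenvalue T (Complex.exp (2 * Complex.I * (Real.pi : ℂ) * (α : ℂ))) := by
  have := hT.nonempty
  have := hT.hausdorff
  have hD : Summable fun n : ℕ => ⨆ x : X,
      distNearestInt (B.pairing α n (B.suffixVector n (φ x))) := (summable_nat_add_iff 1).1 h
  let d : ℕ → X → ℝ := fun n x => nearestIntOffset (α * B.upperHeight n ((φ x).edge n))
  have hdle : ∀ n x, ‖d n x‖ ≤ ⨆ x : X,
      distNearestInt (B.pairing α n (B.suffixVector n (φ x))) := by
    intro n x
    rw [Real.norm_eq_abs, abs_nearestIntOffset, ← pairing_suffixVector]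
    exact le_ciSup (bddAbove_range_distNearestInt fun x => B.pairing α n (B.suffixVector n (φ x))) x
  have hdc : ∀ n, Continuous (d n) := fun n =>
    (continuous_of_discreteTopology
      (f := fun e : B.E n => nearestIntOffset (α * B.upperHeight n e))).comp
        ((continuous_edge n).comp φ.continuous)
  have hds : ∀ x, Summable fun n => d n x := fun x => Summable.of_norm_bounded hD fun n => hdle n x
  have hGc : Continuous fun x => ∑' n, d n x := continuous_tsum hdc hD hdle
  -- Partial sums of the offsets agree modulo 1 with `α` times the exit time, which decreases along
  -- orbits; hence the minus sign.
  let g : X → ℂ := fun x => Complex.exp (-(2 * Complex.I * (Real.pi : ℂ) * ((∑' n, d n x : ℝ) : ℂ)))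
  have hgc : Continuous g := by
    refine Complex.continuous_exp.comp (Continuous.neg (continuous_const.mul ?_))
    exact Complex.continuous_ofReal.comp hGc
  refine ⟨g, hgc, fun h0 => ?_, ?_⟩
  · exact Complex.exp_ne_zero _ (congrFun h0 (Classical.arbitrary X))
  obtain ⟨p, -, hp⟩ := hB.existsUnique_max
  -- At the maximal path every exit time is already `0` and the one-step decrease fails. As no point
  -- is isolated, the identity extends there by continuity.
  have hdense : Dense ({φ.symm p}ᶜ : Set X) := by
    rw [← interior_eq_empty_iff_dense_compl, Set.eq_empty_iff_forall_notMem]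
    intro y hy
    have h1 : y = φ.symm p := Set.mem_singleton_iff.1 (interior_subset hy)
    subst h1
    refine hT.no_isolated_points (φ.symm p) ?_
    rw [← interior_eq_iff_isOpen]
    exact interior_subset.antisymm (Set.singleton_subset_iff.2 hy)
  refine congrFun (Continuous.ext_on hdense (hgc.comp T.continuous) (continuous_const.mul hgc) ?_)
  intro x hx
  have hxp : ¬ B.IsMaxPath (φ x) := fun hmax => hx (by simp [← hp _ hmax])
  have hV := B.vershikMap_spec hB (φ x)
  rw [← hφ] at hV
  obtain ⟨m, hm, htail⟩ : ∃ m, ¬ IsMax ((φ x).edge m) ∧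
      ∀ i, m < i → (φ (T x)).edge i = (φ x).edge i := by
    rcases hV with ⟨h1, -⟩ | ⟨m, -, h2, -, -, h5⟩
    · exact absurd h1 hxp
    · exact ⟨m, h2, h5⟩
  have hE := exitTime_vershikImage (n := m + 1) hV
    fun h0 => hm (exitTime_eq_zero.1 h0 m m.lt_succ_self)
  have hsum : ∀ y, ∑ n ∈ Finset.range (m + 1), d n y =
      α * B.exitTime (m + 1) (φ y) -
        ((∑ n ∈ Finset.range (m + 1), round (α * B.upperHeight n ((φ y).edge n)) : ℤ) : ℝ) := by
    intro y
    simp only [exitTime]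
    push_cast
    rw [Finset.mul_sum, ← Finset.sum_sub_distrib]
    rfl
  have htt : ∑' n, d (n + (m + 1)) (T x) = ∑' n, d (n + (m + 1)) x := by
    refine tsum_congr fun n => ?_
    simp only [d]
    rw [htail _ (by omega)]
  change Complex.exp _ = Complex.exp _ * Complex.exp _
  rw [← Complex.exp_add, Complex.exp_eq_exp_iff_exists_int]
  rw [← (hds (T x)).sum_add_tsum_nat_add (m + 1), ← (hds x).sum_add_tsum_nat_add (m + 1), htt,
    hsum, hsum, hE]
  -- The integer winding is the difference of the total roundings at `T x` and at `x`.
  refine ⟨(∑ n ∈ Finset.range (m + 1), round (α * B.upperHeight n ((φ (T x)).edge n))) -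
    ∑ n ∈ Finset.range (m + 1), round (α * B.upperHeight n ((φ x).edge n)), ?_⟩
  generalize (∑ n ∈ Finset.range (m + 1), round (α * B.upperHeight n ((φ (T x)).edge n))) = k
  generalize (∑ n ∈ Finset.range (m + 1), round (α * B.upperHeight n ((φ x).edge n))) = l
  push_cast
  ring

/-! ### Vertex sequences and suffix sets -/

theorem summable_iSup_suffixSet {X : Type w} [Nonempty X] (φ : X → B.Path)
    (hφ : Function.Surjective φ) {α : ℝ}
    (h : Summable fun n : ℕ => ⨆ x : X,
      distNearestInt (B.pairing α (n + 1) (B.suffixVector (n + 1) (φ x)))) (a : ∀ n, B.V n) :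
    Summable fun n : ℕ => ⨆ s : B.suffixSet (n + 1) (a (n + 1)) (a (n + 2)),
      distNearestInt (B.pairing α (n + 1) s) := by
  refine Summable.of_nonneg_of_le (fun n => Real.iSup_nonneg fun s => distNearestInt_nonneg _)
    -- Positive incidence is not assumed here, so the suffix set may be empty; its real supremum is
    -- then `0`.
    (fun n => Real.iSup_le ?_ (Real.iSup_nonneg fun s => distNearestInt_nonneg _)) h
  rintro ⟨_, x, -, -, rfl⟩
  obtain ⟨y, rfl⟩ := hφ x
  exact le_ciSup (bddAbove_range_distNearestInt fun x =>
    B.pairing α (n + 1) (B.suffixVector (n + 1) (φ x))) y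

theorem summable_iSup_of_suffixSet {X : Type w} [Nonempty X] (φ : X → B.Path) {α : ℝ}
    (h : ∀ a : ∀ n, B.V n, Summable fun n : ℕ =>
      ⨆ s : B.suffixSet (n + 1) (a (n + 1)) (a (n + 2)),
        distNearestInt (B.pairing α (n + 1) s)) :
    Summable fun n : ℕ => ⨆ x : X,
      distNearestInt (B.pairing α (n + 1) (B.suffixVector (n + 1) (φ x))) := by
  have hx : ∀ n : ℕ, ∃ x : X, (⨆ x : X,
      distNearestInt (B.pairing α (n + 1) (B.suffixVector (n + 1) (φ x)))) - (1 / 2) ^ n <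
        distNearestInt (B.pairing α (n + 1) (B.suffixVector (n + 1) (φ x))) := fun n =>
    exists_lt_of_lt_ciSup (sub_lt_self _ (by positivity))
  choose x hx using hx
  suffices hs : Summable fun n : ℕ =>
      distNearestInt (B.pairing α (n + 1) (B.suffixVector (n + 1) (φ (x n)))) by
    refine Summable.of_nonneg_of_le (fun n => Real.iSup_nonneg fun s => distNearestInt_nonneg _)
      (fun n => ?_) (hs.add summable_geometric_two)
    linarith [hx n]
  have key : ∀ (a : ∀ n, B.V n) (n : ℕ), a (n + 1) = (φ (x n)).vertex (n + 1) →
      a (n + 2) = (φ (x n)).vertex (n + 2) →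
      distNearestInt (B.pairing α (n + 1) (B.suffixVector (n + 1) (φ (x n)))) ≤
        ⨆ s : B.suffixSet (n + 1) (a (n + 1)) (a (n + 2)),
          distNearestInt (B.pairing α (n + 1) s) := by
    intro a n h1 h2
    exact le_ciSup (bddAbove_range_distNearestInt
      fun s : B.suffixSet (n + 1) (a (n + 1)) (a (n + 2)) => B.pairing α (n + 1) s)
        ⟨_, φ (x n), h1.symm, h2.symm, rfl⟩
  set q : ℕ → ℝ := fun n =>
    distNearestInt (B.pairing α (n + 1) (B.suffixVector (n + 1) (φ (x n)))) with hq
  have hq0 : ∀ n, 0 ≤ q n := fun n => distNearestInt_nonneg _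
  -- The near-maximizer `x n` prescribes vertices at levels `n + 1` and `n + 2`, so consecutive
  -- indices may conflict while indices of equal parity do not.
  have half : ∀ r : ℕ, Summable fun k : ℕ => q (2 * k + r) := by
    intro r
    -- Levels `2k + r + 1` and `2k + r + 2` both give `(n - r - 1) / 2 = k`, so both vertices come
    -- from the path of `x (2k + r)`.
    let a : ∀ n, B.V n := fun n => (φ (x (2 * ((n - r - 1) / 2) + r))).vertex n
    have hinj : Function.Injective fun k : ℕ => 2 * k + r := by
      intro i j hij
      simp only at hij
      omega
    refine Summable.of_nonneg_of_le (fun k => hq0 _)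
      (fun k => key a (2 * k + r) ?_ ?_) ((h a).comp_injective hinj)
    · have : 2 * ((2 * k + r + 1 - r - 1) / 2) + r = 2 * k + r := by omega
      simp only [a, this]
    · have : 2 * ((2 * k + r + 2 - r - 1) / 2) + r = 2 * k + r := by omega
      simp only [a, this]
  have h0 : Summable fun k : ℕ => q (2 * k) := half 0
  exact (h0.hasSum.even_add_odd (half 1).hasSum).summable

end OrderedBratteliDiagram

theorem mainTheorem1 {X : Type w} [TopologicalSpace X] (T : X ≃ₜ X) (hT : IsMinimalCantorSystem T)
    (B : OrderedBratteliDiagram.{u, v}) (hB : B.IsProper) (φ : X ≃ₜ B.Path)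
    (hφ : OrderedBratteliDiagram.IsConjugacy T B hB.properlyOrdered φ) (α : ℝ) :
    List.TFAE
      [ IsContinuousEigenvalue T (Complex.exp (2 * Complex.I * (Real.pi : ℂ) * (α : ℂ))),
        Summable fun n : ℕ => ⨆ x : X,
          distNearestInt (B.pairing α (n + 1) (B.suffixVector (n + 1) (φ x))),
        ∀ a : (n : ℕ) → B.V n, Summable fun n : ℕ =>
          ⨆ s : B.suffixSet (n + 1) (a (n + 1)) (a (n + 2)),
            distNearestInt (B.pairing α (n + 1) s) ] := by
  have := hT.nonempty
  tfae_have 1 → 2 := OrderedBratteliDiagram.summable_iSup_of_eigenvalue hT hB hφ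
  tfae_have 2 → 1 := OrderedBratteliDiagram.eigenvalue_of_summable_iSup hT hφ
  tfae_have 2 → 3 := OrderedBratteliDiagram.summable_iSup_suffixSet φ φ.surjective
  tfae_have 3 → 2 := OrderedBratteliDiagram.summable_iSup_of_suffixSet φ
  tfae_finish
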